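/- **Maximum principle on closed cone surfaces.** A *closed cone surface* $(\mathcal M,(p_1,\dots,p_n),g_0)$ is a nonempty compact (Hausdorff) topological surface $\mathcal M$ with finitely many points $p_1,\dots,p_n\in\mathcal M$ ($n\ge 0$), a smooth structure on $\mathcal M\setminus\{p_1,\dots,p_n\}$ and a smooth Riemannian metric $g_0$ there, such that every $p_i$ has an open neighbourhood $U_i$ containing no other $p_j$, and a homeomorphism $(U_i,p_i)\to(D,0)$ onto an open disc $D\subset\mathbb R^2$ centred at $0$, which is a diffeomorphism from $U_i\setminus\{p_i\}$ onto $D\setminus\{0\}$ and in whose polar coordinates $$g_0=e^{2(a_i+\beta_i\ln r)}\,(dr^2+r^2d\theta^2),\qquad \beta_i=\frac{\alpha_i}{2\pi}-1,$$ with $a_i:D\to\mathbb R$ bounded and continuous on the whole disc and cone angle $\alpha_i\in(0,2\pi]$. Let $T>0$ and let $u:\mathcal M\times[0,T]\to\mathbb R$ be continuous and of class $C^{2,1}(\mathcal M\times(0,T],g_0)$: on $\mathcal M\setminus\{p_1,\dots,p_n\}$ and for times in $(0,T]$, $u$ is $C^2$ in space and $C^1$ in time, and $$\sup|u|+\sup|\nabla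 u|+\sup|\nabla^2u|<\infty,$$ the suprema being over $(\mathcal M\setminus\{p_1,\dots,p_n\})\times(0,T]$ and $\nabla$, the norms taken with respect to $g_0$. Suppose that on $(\mathcal M\setminus\{p_1,\dots,p_n\})\times(0,T]$ $$\frac{\partial u}{\partial t}\le\Delta u,$$ where $\Delta=\operatorname{trace}\nabla^2$ is the Laplacian of $g_0$ (and $\partial u/\partial t$ at $t=T$ is the left derivative). Then the maximum of $u$ over $\mathcal M\times[0,T]$ is attained at time $t=0$: there is $y_0\in\mathcal M$ with $$u(y_0,0)=\max_{\mathcal M\times[0,T]}u .$$ -/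

import Mathlib

open scoped Manifold ContDiff

noncomputable section

namespace ConeMax

/-- The Euclidean plane, the model space of all charts. -/
abbrev Plane : Type := EuclideanSpace ℝ (Fin 2)

/-- The `i`-th standard basis vector of the plane. -/
def stdVec (i : Fin 2) : Plane := EuclideanSpace.single i (1 : ℝ)

/-! ### Riemannian calculus in coordinates

In this section `G` is the matrix field `(g_ij)` of a Riemannian metric in a coordinate domain of the
plane, and `f` is a function in these coordinates. -/

/-- The partial derivative `∂_i f` at `y`. -/
def pd (i : Fin 2) (f : Plane → ℝ) (y : Plane) : ℝ := fderiv ℝ f y (stdVec i)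

/-- The Christoffel symbol `Γ^k_ij` of the Levi-Civita connection,
`½ ∑ₗ g^{kl} (∂_i g_jl + ∂_j g_il - ∂_l g_ij)`. -/
def christoffel (G : Plane → Matrix (Fin 2) (Fin 2) ℝ) (i j k : Fin 2) (y : Plane) : ℝ :=
  (1 / 2) * ∑ l, ((G y)⁻¹ k l) *
    (pd i (fun z => G z j l) y + pd j (fun z => G z i l) y - pd l (fun z => G z i j) y)

/-- The components of the Hessian `∇²f`: `∂_i ∂_j f - ∑ₖ Γ^k_ij ∂_k f`. -/
def coordHess (G : Plane → Matrix (Fin 2) (Fin 2) ℝ) (f : Plane → ℝ) (i j : Fin 2)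
    (y : Plane) : ℝ :=
  pd i (fun z => pd j f z) y - ∑ k, christoffel G i j k y * pd k f y

/-- The Laplacian, the trace of the Hessian: `∑ g^{ij} (∇²f)_ij`. -/
def coordLap (G : Plane → Matrix (Fin 2) (Fin 2) ℝ) (f : Plane → ℝ) (y : Plane) : ℝ :=
  ∑ i, ∑ j, ((G y)⁻¹ i j) * coordHess G f i j y

/-- The norm `|∇f|` with respect to the metric: `(∑ g^{ij} ∂_i f ∂_j f)^{1/2}`. -/
def coordGradNorm (G : Plane → Matrix (Fin 2) (Fin 2) ℝ) (f : Plane → ℝ) (y : Plane) : ℝ :=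
  Real.sqrt (∑ i, ∑ j, ((G y)⁻¹ i j) * (pd i f y * pd j f y))

/-- The norm `|∇²f|` with respect to the metric:
`(∑ g^{ik} g^{jl} (∇²f)_ij (∇²f)_kl)^{1/2}`. -/
def coordHessNorm (G : Plane → Matrix (Fin 2) (Fin 2) ℝ) (f : Plane → ℝ) (y : Plane) : ℝ :=
  Real.sqrt (∑ i, ∑ j, ∑ k, ∑ l,
    ((G y)⁻¹ i k) * ((G y)⁻¹ j l) * (coordHess G f i j y * coordHess G f k l y))

/-! ### Smooth Riemannian surfaces and cone points -/

/-- A smooth Riemannian metric on a smooth surface `X`. -/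
abbrev SmoothMetric (X : Type*) [TopologicalSpace X] [ChartedSpace Plane X]
    [IsManifold (𝓡 2) ∞ X] : Type _ :=
  Bundle.ContMDiffRiemannianMetric (𝓡 2) ∞ Plane (fun x : X => TangentSpace (𝓡 2) x)

/-- The matrix `g_ij = g(∂_i, ∂_j)` of a Riemannian metric `g` in the coordinates of `χ`, as a
function on the target of `χ`; here `∂_i` is the image of the `i`-th standard basis vector under
the differential of `χ⁻¹`. -/
def metricMatrix {X : Type*} [TopologicalSpace X] [ChartedSpace Plane X]
    [IsManifold (𝓡 2) ∞ X] (g : SmoothMetric X) (χ : OpenPartialHomeomorph X Plane)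
    (y : Plane) : Matrix (Fin 2) (Fin 2) ℝ :=
  Matrix.of fun i j =>
    g.inner (χ.symm y)
      ((mfderiv (𝓡 2) (𝓡 2) χ.symm y : Plane →L[ℝ] TangentSpace (𝓡 2) (χ.symm y)) (stdVec i))
      ((mfderiv (𝓡 2) (𝓡 2) χ.symm y : Plane →L[ℝ] TangentSpace (𝓡 2) (χ.symm y)) (stdVec j))

/-- `p` is a cone point, of cone angle `α`, of the topological space `M` whose part
`M ∖ S` is a smooth surface with the smooth Riemannian metric `g`: there is a homeomorphism `κ`
of a neighbourhood of `p` onto an open disc `D` centred at `0`, sending `p` to `0` and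
restricting to a diffeomorphism from the punctured neighbourhood onto `D ∖ {0}` (i.e. to a chart `χ`
of the smooth structure), such that in these coordinates
`g = e^{2(a + β log r)} (dr² + r² dθ²)`, where `β = α / 2π - 1` and `a` is bounded and continuous
on the whole of `D`. -/
def IsConePoint {M : Type*} [TopologicalSpace M] (S : Finset M)
    [ChartedSpace Plane {x : M // x ∉ S}] [IsManifold (𝓡 2) ∞ {x : M // x ∉ S}]
    (g : SmoothMetric {x : M // x ∉ S}) (p : M) (α : ℝ) : Prop :=
  ∃ (ρ : ℝ) (κ : OpenPartialHomeomorph M Plane)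
    (χ : OpenPartialHomeomorph {x : M // x ∉ S} Plane) (a : Plane → ℝ),
    0 < ρ ∧ p ∈ κ.source ∧ κ p = 0 ∧ κ.target = Metric.ball 0 ρ ∧
    (∀ q ∈ κ.source, q ∈ S → q = p) ∧
    χ ∈ IsManifold.maximalAtlas (𝓡 2) ∞ {x : M // x ∉ S} ∧
    χ.source = Subtype.val ⁻¹' κ.source ∧
    (∀ x ∈ χ.source, χ x = κ (x : M)) ∧
    ContinuousOn a (Metric.ball 0 ρ) ∧
    (∃ A : ℝ, ∀ y ∈ Metric.ball (0 : Plane) ρ, |a y| ≤ A) ∧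
    ∀ y ∈ Metric.ball (0 : Plane) ρ, y ≠ 0 →
      metricMatrix g χ y =
        Real.exp (2 * (a y + (α / (2 * Real.pi) - 1) * Real.log ‖y‖)) •
          (1 : Matrix (Fin 2) (Fin 2) ℝ)

/-- A cone surface on the topological space `M`: a finite set of points, a smooth structure and
a smooth Riemannian metric on the complement, such that the given points are
cone points with cone angles in `(0, 2π]`. -/
structure ConeSurface (M : Type*) [TopologicalSpace M] where
  /-- the set of cone points -/
  sing : Finset M
  /-- the smooth atlas of the complement of the cone points -/
  charted : ChartedSpace Plane {x : M // x ∉ sing}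
  /-- the charts are smoothly compatible -/
  smooth : IsManifold (𝓡 2) ∞ {x : M // x ∉ sing}
  /-- the Riemannian metric -/
  metric : SmoothMetric {x : M // x ∉ sing}
  /-- the cone angles -/
  angle : M → ℝ
  angle_pos : ∀ p ∈ sing, 0 < angle p
  angle_le : ∀ p ∈ sing, angle p ≤ 2 * Real.pi
  cone : ∀ p ∈ sing, IsConePoint sing metric p (angle p)

namespace ConeSurface

variable {M : Type*} [TopologicalSpace M]

/-- The smooth part `M ∖ {p₁, …, pₙ}`. -/
abbrev Reg (C : ConeSurface M) : Type _ := {x : M // x ∉ C.sing}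

instance (C : ConeSurface M) : ChartedSpace Plane C.Reg := C.charted

instance (C : ConeSurface M) : IsManifold (𝓡 2) ∞ C.Reg := C.smooth

/-- The coordinate charts of the smooth part: all charts of its maximal smooth atlas. -/
def charts (C : ConeSurface M) : Set (OpenPartialHomeomorph C.Reg Plane) :=
  IsManifold.maximalAtlas (𝓡 2) ∞ C.Reg

/-- The Laplacian of `f : M → ℝ` at the smooth point `x`, computed in the chart `χ` around `x`. -/
def lap (C : ConeSurface M) (χ : OpenPartialHomeomorph C.Reg Plane) (f : M → ℝ) (x : C.Reg) : ℝ :=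
  coordLap (metricMatrix C.metric χ) (fun y => f (χ.symm y : C.Reg)) (χ x)

/-- `|∇f|` at the smooth point `x`, computed in the chart `χ` around `x`. -/
def gradNorm (C : ConeSurface M) (χ : OpenPartialHomeomorph C.Reg Plane) (f : M → ℝ)
    (x : C.Reg) : ℝ :=
  coordGradNorm (metricMatrix C.metric χ) (fun y => f (χ.symm y : C.Reg)) (χ x)

/-- `|∇²f|` at the smooth point `x`, computed in the chart `χ` around `x`. -/
def hessNorm (C : ConeSurface M) (χ : OpenPartialHomeomorph C.Reg Plane) (f : M → ℝ)
    (x : C.Reg) : ℝ :=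
  coordHessNorm (metricMatrix C.metric χ) (fun y => f (χ.symm y : C.Reg)) (χ x)

/-- `u ∈ C^{2,1}(M × (0,T])`: on the smooth part, `u` is `C²` in space and `C¹` in time on
`(0,T]`, and the `C²`-norm `sup |u| + sup |∇u| + sup |∇²u|` is finite; the suprema are over all
smooth points and all times in `(0,T]`, and the norms are those of the metric. -/
structure C21 (C : ConeSurface M) (T : ℝ) (u : M → ℝ → ℝ) : Prop where
  space : ∀ t ∈ Set.Ioc (0 : ℝ) T, ContMDiff (𝓡 2) 𝓘(ℝ, ℝ) 2 (fun x : C.Reg => u x t)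
  time : ∀ x : C.Reg, ContDiffOn ℝ 1 (u x) (Set.Ioc (0 : ℝ) T)
  bound : ∃ K : ℝ, ∀ t ∈ Set.Ioc (0 : ℝ) T, ∀ x : C.Reg, |u x t| ≤ K ∧
    ∀ χ ∈ C.charts, x ∈ χ.source →
      C.gradNorm χ (fun q => u q t) x ≤ K ∧ C.hessNorm χ (fun q => u q t) x ≤ K

/-- `∂u/∂t ≤ Δu` at every smooth point and every time in `(0,T]` (at `t = T` the time derivative
is the left derivative). The Laplacian does not depend on the chart, and any chart may be
used. -/
def HeatSubsolution (C : ConeSurface M) (T : ℝ) (u : M → ℝ → ℝ) : Prop :=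
  ∀ t ∈ Set.Ioc (0 : ℝ) T, ∀ x : C.Reg, ∀ χ ∈ C.charts, x ∈ χ.source →
    derivWithin (u x) (Set.Ioc (0 : ℝ) T) t ≤ C.lap χ (fun q => u q t) x

end ConeSurface

end ConeMax

end

/-! Suppose `u` exceeds somewhere the maximum of its initial values. Then for suitable small `ε, k >
0` the maximum of `v = u + ε φ - k t` over space-time lies at a positive time, where `φ` is a
bounded barrier with `Δφ ≥ -B` and `k > ε B`. Both possible positions of this maximum are excluded
(`time_eq_zero_of_isMaxOn`).

At a smooth point, let `w` be `C²` and touch `φ` from below. The second derivative test gives `Δu +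
ε Δw ≤ 0`, while maximality in time gives `∂u/∂t ≥ k`. Hence `k ≤ ∂u/∂t ≤ Δu ≤ ε B`, which is false.

At a cone point, put `γ = α / 2π`. The metric is `e^{2a} r^{2γ-2}` times the flat one, so bounded
`|∇u|` means that the radial derivative of `u` is `O(r^{γ-1})`, and `u` drops from its value at the
tip by at most `O(r^γ)`. The barrier grows like `r^{γ/2}`, which is faster, so the tip is no
maximum.

The barrier (`exists_barrier_at`) is the positive part of `r^{2m} - c r²` with `m = γ / 4`. Its flat
Laplacian is at least `-4c`, and `α ≤ 2π` keeps the inverse conformal factor bounded near the tip.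
-/

noncomputable section

namespace ConeMax

/-! ### Second derivative test for the coordinate Laplacian -/

/-- The second derivative of a function of one variable is nonpositive at a local maximum. -/
theorem deriv_deriv_nonpos_of_isLocalMax {f : ℝ → ℝ} {x : ℝ} (hf : ContinuousAt f x)
    (h : IsLocalMax f x) : deriv (deriv f) x ≤ 0 := by
  by_contra! hpos
  -- A positive second derivative would make `x` a local minimum too, so `f` would be constant near
  -- `x`.
  have hmin := isLocalMin_of_deriv_deriv_pos hpos h.deriv_eq_zero hf
  have hconst : f =ᶠ[nhds x] fun _ => f x := by
    filter_upwards [h, hmin] with z h1 h2 using le_antisymm h1 h2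
  have : deriv (deriv f) x = 0 := by
    rw [(hconst.deriv).deriv_eq]
    simp
  exact hpos.ne' this

theorem contDiffAt_pd {f : Plane → ℝ} {y : Plane} (hf : ContDiffAt ℝ 2 f y) (i : Fin 2) :
    ContDiffAt ℝ 1 (fun z => pd i f z) y :=
  (hf.fderiv_right (m := 1) (by norm_num)).clm_apply contDiffAt_const

theorem differentiableAt_pd {f : Plane → ℝ} {y : Plane} (hf : ContDiffAt ℝ 2 f y) (i : Fin 2) :
    DifferentiableAt ℝ (fun z => pd i f z) y :=
  (contDiffAt_pd hf i).differentiableAt (by norm_num)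

theorem eventually_differentiableAt {f : Plane → ℝ} {y : Plane} (hf : ContDiffAt ℝ 2 f y) :
    ∀ᶠ z in nhds y, DifferentiableAt ℝ f z :=
  (hf.eventually (by simp)).mono fun _ h => h.differentiableAt (by norm_num)

theorem pd_add_const_mul {f w : Plane → ℝ} {y : Plane} (hf : DifferentiableAt ℝ f y)
    (hw : DifferentiableAt ℝ w y) (ε : ℝ) (i : Fin 2) :
    pd i (fun z => f z + ε * w z) y = pd i f y + ε * pd i w y := by
  have h := (hf.hasFDerivAt.add (hw.hasFDerivAt.const_mul ε)).fderiv
  have h' : fderiv ℝ (fun z => f z + ε * w z) y = fderiv ℝ f y + ε • fderiv ℝ w y := h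
  simp [pd, h']

theorem coordLap_add_const_mul (G : Plane → Matrix (Fin 2) (Fin 2) ℝ) {f w : Plane → ℝ}
    {y : Plane} (hf : ContDiffAt ℝ 2 f y) (hw : ContDiffAt ℝ 2 w y) (ε : ℝ) :
    coordLap G (fun z => f z + ε * w z) y = coordLap G f y + ε * coordLap G w y := by
  have h1 : ∀ k, pd k (fun z => f z + ε * w z) y = pd k f y + ε * pd k w y := fun k =>
    pd_add_const_mul (hf.differentiableAt (by norm_num)) (hw.differentiableAt (by norm_num)) ε k
  have h2 : ∀ i j, pd i (fun z => pd j (fun z => f z + ε * w z) z) y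
      = pd i (fun z => pd j f z) y + ε * pd i (fun z => pd j w z) y := by
    intro i j
    rw [← pd_add_const_mul (differentiableAt_pd hf j) (differentiableAt_pd hw j)]
    have : (fun z => pd j (fun z => f z + ε * w z) z) =ᶠ[nhds y]
        fun z => pd j f z + ε * pd j w z := by
      filter_upwards [eventually_differentiableAt hf, eventually_differentiableAt hw]
        with z hz1 hz2 using pd_add_const_mul hz1 hz2 ε j
    simp only [pd] at this ⊢
    rw [this.fderiv_eq]
  simp only [coordLap, coordHess, h1, h2, Fin.sum_univ_two]
  ring

/-- The second derivative test along a line. -/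
theorem sum_pd_pd_nonpos_of_isLocalMax {f : Plane → ℝ} {y : Plane} (hf : ContDiffAt ℝ 2 f y)
    (h : IsLocalMax f y) (b : Fin 2 → ℝ) :
    ∑ i, ∑ j, b i * b j * pd i (fun z => pd j f z) y ≤ 0 := by
  set v : Plane := ∑ i, b i • stdVec i with hv
  let γ : ℝ → Plane := fun s => y + s • v
  have hγ : ∀ s, HasDerivAt γ v s := fun s => by
    have h := ((hasDerivAt_id s).smul_const v).const_add y
    rw [one_smul] at h
    exact h
  have hγ0 : γ 0 = y := by simp [γ]
  have hcont : Filter.Tendsto γ (nhds 0) (nhds y) := by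
    have := (hγ 0).continuousAt.tendsto
    rwa [hγ0] at this
  have hmax : IsLocalMax (f ∘ γ) 0 := by
    have := hcont.eventually h
    simpa [IsLocalMax, IsMaxFilter, hγ0] using this
  have hd1 : deriv (f ∘ γ) =ᶠ[nhds 0] fun s => ∑ j, b j * pd j f (γ s) := by
    filter_upwards [hcont.eventually (eventually_differentiableAt hf)] with s hs
    have := (hs.hasFDerivAt.comp_hasDerivAt s (hγ s)).deriv
    rw [this, hv]
    simp [pd]
  have hd2 : deriv (deriv (f ∘ γ)) 0 = ∑ j, b j * ∑ i, b i * pd i (fun z => pd j f z) y := by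
    rw [hd1.deriv_eq]
    have : HasDerivAt (fun s => ∑ j, b j * pd j f (γ s))
        (∑ j, b j * (fderiv ℝ (fun z => pd j f z) y v)) 0 := by
      refine HasDerivAt.fun_sum fun j _ => HasDerivAt.const_mul _ ?_
      have h3 := (differentiableAt_pd hf j).hasFDerivAt
      rw [← hγ0] at h3
      have := h3.comp_hasDerivAt (0 : ℝ) (hγ 0)
      rw [hγ0] at this
      exact this
    rw [this.deriv, hv]
    simp [pd]
  have hle := deriv_deriv_nonpos_of_isLocalMax (f := f ∘ γ) (x := 0)
    (ContinuousAt.comp (by rw [hγ0]; exact hf.continuousAt) (hγ 0).continuousAt) hmax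
  rw [hd2] at hle
  simp only [Fin.sum_univ_two] at hle ⊢
  linarith

-- At a critical point the Christoffel terms vanish. Factoring the inverse metric as `Bᵀ B` turns
-- the remaining trace into a sum of second derivatives along the rows of `B`.
open scoped MatrixOrder Matrix.Norms.L2Operator in
theorem coordLap_nonpos_of_isLocalMax {G : Plane → Matrix (Fin 2) (Fin 2) ℝ} {f : Plane → ℝ}
    {y : Plane} (hG : (G y).PosSemidef) (hf : ContDiffAt ℝ 2 f y) (h : IsLocalMax f y) :
    coordLap G f y ≤ 0 := by
  obtain ⟨B, hB⟩ := CStarAlgebra.nonneg_iff_eq_star_mul_self.mp hG.inv.nonneg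
  have h0 : ∀ k, pd k f y = 0 := fun k => by simp [pd, h.fderiv_eq_zero]
  have h1 := sum_pd_pd_nonpos_of_isLocalMax hf h (B 0)
  have h2 := sum_pd_pd_nonpos_of_isLocalMax hf h (B 1)
  simp only [coordLap, coordHess, h0, hB, Matrix.mul_apply, Matrix.star_apply,
    Fin.sum_univ_two, star_trivial] at h1 h2 ⊢
  linarith

theorem coordLap_zero (G : Plane → Matrix (Fin 2) (Fin 2) ℝ) (y : Plane) :
    coordLap G (fun _ => 0) y = 0 := by
  simp [coordLap, coordHess, pd]

/-! ### Conformally flat metrics -/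

theorem inv_smul_one (e : ℝ) : (e • (1 : Matrix (Fin 2) (Fin 2) ℝ))⁻¹ = e⁻¹ • 1 := by
  by_cases he : e = 0
  · simp [he]
  · exact Matrix.inv_eq_left_inv (by simp [smul_smul, he])

/-- In two dimensions the Laplacian of a conformally flat metric is a multiple of the flat one. -/
theorem coordLap_conformal {G : Plane → Matrix (Fin 2) (Fin 2) ℝ} {E : Plane → ℝ} {y : Plane}
    (hG : ∀ᶠ z in nhds y, G z = E z • (1 : Matrix (Fin 2) (Fin 2) ℝ)) (f : Plane → ℝ) :
    coordLap G f y = (E y)⁻¹ * ∑ i, pd i (fun z => pd i f z) y := by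
  have hpd : ∀ l i j, pd l (fun z => G z i j) y
      = pd l E y * (1 : Matrix (Fin 2) (Fin 2) ℝ) i j := by
    intro l i j
    have : (fun z => G z i j) =ᶠ[nhds y] fun z => E z * (1 : Matrix (Fin 2) (Fin 2) ℝ) i j := by
      filter_upwards [hG] with z hz
      simp [hz]
    simp only [pd]
    rw [this.fderiv_eq]
    by_cases hij : i = j
    · subst hij; simp
    · simp [Matrix.one_apply_ne hij]
  -- The contractions `g^{ij} Γ^k_ij` cancel exactly in dimension two.
  simp only [coordLap, coordHess, christoffel, hpd, hG.self_of_nhds, inv_smul_one,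
    Fin.sum_univ_two, Matrix.smul_apply, smul_eq_mul]
  simp
  ring

theorem coordGradNorm_conformal {G : Plane → Matrix (Fin 2) (Fin 2) ℝ} {e : ℝ} {y : Plane}
    (hG : G y = e • (1 : Matrix (Fin 2) (Fin 2) ℝ)) (f : Plane → ℝ) :
    coordGradNorm G f y = Real.sqrt (e⁻¹ * ∑ i, pd i f y ^ 2) := by
  simp only [coordGradNorm, hG, inv_smul_one, Fin.sum_univ_two, Matrix.smul_apply, smul_eq_mul]
  congr 1
  simp
  ring

/-! ### A radial barrier -/

/-- The function `r ^ (2m) - c r²` of the distance `r` to the origin. -/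
def radialBarrier (m c : ℝ) (y : Plane) : ℝ := (‖y‖ ^ 2) ^ m - c * ‖y‖ ^ 2

theorem continuous_radialBarrier {m : ℝ} (hm : 0 ≤ m) (c : ℝ) :
    Continuous (radialBarrier m c) := by
  unfold radialBarrier
  exact ((continuous_norm.pow 2).rpow_const fun _ => Or.inr hm).sub (by fun_prop)

theorem contDiffAt_radialBarrier (m c : ℝ) {y : Plane} (hy : y ≠ 0) :
    ContDiffAt ℝ 2 (radialBarrier m c) y := by
  have h : ContDiffAt ℝ 2 (fun z : Plane => ‖z‖ ^ 2) y := (contDiff_norm_sq ℝ).contDiffAt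
  exact (h.rpow_const_of_ne (by simpa using hy)).sub (contDiffAt_const.mul h)

theorem hasFDerivAt_coord (i : Fin 2) (y : Plane) :
    HasFDerivAt (fun z : Plane => z i) (EuclideanSpace.proj i : Plane →L[ℝ] ℝ) y :=
  (EuclideanSpace.proj i : Plane →L[ℝ] ℝ).hasFDerivAt

theorem pd_radialBarrier (m c : ℝ) {y : Plane} (hy : y ≠ 0) (i : Fin 2) :
    pd i (radialBarrier m c) y = 2 * y i * (m * (‖y‖ ^ 2) ^ (m - 1) - c) := by
  have h : HasFDerivAt (fun z : Plane => ‖z‖ ^ 2) (2 • innerSL ℝ y) y :=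
    (hasStrictFDerivAt_norm_sq y).hasFDerivAt
  have h2 := (h.rpow_const (p := m) (Or.inl (by simpa using hy))).sub (h.const_mul c)
  have h3 : fderiv ℝ (radialBarrier m c) y = _ := h2.fderiv
  rw [pd, h3]
  simp [stdVec, EuclideanSpace.inner_single_right]
  ring

/-- The coefficients of the power combine to `4m + 4m(m - 1) = 4m²`. This term is nonnegative, so
only `-4c` can make the Laplacian negative. -/
theorem flatLap_radialBarrier (m c : ℝ) {y : Plane} (hy : y ≠ 0) :
    ∑ i, pd i (fun z => pd i (radialBarrier m c) z) y
      = 4 * m ^ 2 * (‖y‖ ^ 2) ^ (m - 1) - 4 * c := by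
  have hq : (0 : ℝ) < ‖y‖ ^ 2 := by positivity
  have key : ∀ i, pd i (fun z => pd i (radialBarrier m c) z) y
      = 2 * (m * (‖y‖ ^ 2) ^ (m - 1) - c)
        + 4 * y i ^ 2 * (m * (m - 1) * (‖y‖ ^ 2) ^ (m - 1 - 1)) := by
    intro i
    have hev : (fun z => pd i (radialBarrier m c) z) =ᶠ[nhds y]
        fun z => (2 * z i) * (m * (‖z‖ ^ 2) ^ (m - 1) - c) := by
      filter_upwards [isOpen_ne.mem_nhds hy] with z hz using pd_radialBarrier m c hz i
    have h : HasFDerivAt (fun z : Plane => ‖z‖ ^ 2) (2 • innerSL ℝ y) y :=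
      (hasStrictFDerivAt_norm_sq y).hasFDerivAt
    have h2 := ((h.rpow_const (p := m - 1) (Or.inl hq.ne')).const_mul m).sub_const c
    have h3 := ((hasFDerivAt_coord i y).const_mul 2).mul h2
    have h4 : fderiv ℝ (fun z : Plane => (2 * z i) * (m * (‖z‖ ^ 2) ^ (m - 1) - c)) y = _ :=
      h3.fderiv
    rw [pd, hev.fderiv_eq, h4]
    simp [stdVec, EuclideanSpace.inner_single_right]
    ring
  have hn : ‖y‖ ^ 2 = y 0 ^ 2 + y 1 ^ 2 := by
    rw [EuclideanSpace.norm_sq_eq]; simp [Fin.sum_univ_two]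
  have hp : (‖y‖ ^ 2) ^ (m - 1) = (‖y‖ ^ 2) ^ (m - 1 - 1) * (y 0 ^ 2 + y 1 ^ 2) := by
    rw [← hn, Real.rpow_sub_one hq.ne' (m - 1)]
    field_simp
  simp only [Fin.sum_univ_two, key]
  rw [hp]
  ring

/-- The pullback of an inner product by any linear map is semidefinite, so injectivity of the
differential is not needed. -/
theorem metricMatrix_posSemidef {X : Type*} [TopologicalSpace X] [ChartedSpace Plane X]
    [IsManifold (𝓡 2) ∞ X] (g : SmoothMetric X) (χ : OpenPartialHomeomorph X Plane) (y : Plane) :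
    (metricMatrix g χ y).PosSemidef := by
  refine Matrix.PosSemidef.of_dotProduct_mulVec_nonneg ?_ fun b => ?_
  · ext i j
    simp only [metricMatrix, Matrix.conjTranspose_apply, Matrix.of_apply, star_trivial]
    exact g.symm _ _ _
  · have hnn : ∀ v : TangentSpace (𝓡 2) (χ.symm y), 0 ≤ g.inner (χ.symm y) v v := fun v => by
      by_cases hv : v = 0
      · simp [hv]
      · exact (g.pos _ v hv).le
    have key : ∀ D : Plane →L[ℝ] TangentSpace (𝓡 2) (χ.symm y),
        0 ≤ star b ⬝ᵥ (Matrix.of fun i j : Fin 2 =>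
          g.inner (χ.symm y) (D (stdVec i)) (D (stdVec j))).mulVec b := by
      intro D
      have h := hnn (b 0 • D (stdVec 0) + b 1 • D (stdVec 1))
      simp only [map_add, map_smul, add_apply, smul_apply, smul_eq_mul] at h
      simp only [dotProduct, Matrix.mulVec, Fin.sum_univ_two, Matrix.of_apply, Pi.star_apply,
        star_trivial]
      linarith
    exact key _

/-! ### Growth estimates near a cone point -/

/-- A function bounded below in slope by an integrable power near `0`. -/
theorem sub_rpow_le_of_deriv_ge {h : ℝ → ℝ} {ρ L γ : ℝ} (hγ : 0 < γ)
    (hc : ContinuousOn h (Set.Ico 0 ρ)) (hd : ∀ s ∈ Set.Ioo 0 ρ, DifferentiableAt ℝ h s)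
    (hb : ∀ s ∈ Set.Ioo 0 ρ, -(L * s ^ (γ - 1)) ≤ deriv h s) {s : ℝ} (hs : s ∈ Set.Ico 0 ρ) :
    h 0 - L / γ * s ^ γ ≤ h s := by
  have hmono : MonotoneOn (fun s => h s + L / γ * s ^ γ) (Set.Ico 0 ρ) := by
    have hder : ∀ s ∈ Set.Ioo 0 ρ,
        HasDerivAt (fun s => h s + L / γ * s ^ γ) (deriv h s + L / γ * (γ * s ^ (γ - 1))) s :=
      fun s hs => (hd s hs).hasDerivAt.add
        ((Real.hasDerivAt_rpow_const (Or.inl hs.1.ne')).const_mul _)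
    refine monotoneOn_of_deriv_nonneg (convex_Ico 0 ρ) ?_ ?_ ?_
    · exact hc.add (continuousOn_const.mul
        (Real.continuous_rpow_const hγ.le).continuousOn)
    · rw [interior_Ico]
      exact fun s hs => (hder s hs).differentiableAt.differentiableWithinAt
    · rw [interior_Ico]
      intro s hs
      rw [(hder s hs).deriv]
      have h1 := hb s hs
      have h2 : L / γ * (γ * s ^ (γ - 1)) = L * s ^ (γ - 1) := by field_simp
      rw [h2]
      linarith
  have := hmono (Set.left_mem_Ico.mpr (hs.1.trans_lt hs.2)) hs hs.1
  simp only [Real.zero_rpow hγ.ne', mul_zero, add_zero] at this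
  linarith

theorem not_forall_rpow_le {ε ρ L c m : ℝ} (hε : 0 < ε) (hρ : 0 < ρ) (hm : 0 < m) (hm1 : m < 1) :
    -- Dividing by `s ^ (2 * m)` and letting `s` tend to `0` would give `ε ≤ 0`.
    ¬ ∀ s ∈ Set.Ioo 0 ρ, ε * ((s ^ 2) ^ m - c * s ^ 2) ≤ L * s ^ (4 * m) := by
  intro h
  have hq : ∀ s ∈ Set.Ioo 0 ρ, ε * (1 - c * s ^ (2 - 2 * m)) ≤ L * s ^ (2 * m) := by
    intro s hs
    have hs0 : 0 < s := hs.1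
    have h1 : (s ^ 2) ^ m = s ^ (2 * m) := by
      rw [← Real.rpow_natCast, ← Real.rpow_mul hs0.le]; norm_num
    have h2 : s ^ 2 = s ^ (2 * m) * s ^ (2 - 2 * m) := by
      rw [← Real.rpow_add hs0, ← Real.rpow_natCast]; congr 1; push_cast; ring
    have h3 : s ^ (4 * m) = s ^ (2 * m) * s ^ (2 * m) := by
      rw [← Real.rpow_add hs0]; congr 1; ring
    have hpos : 0 < s ^ (2 * m) := Real.rpow_pos_of_pos hs0 _
    have := h s hs
    rw [h1, h3, h2] at this
    refine le_of_mul_le_mul_left ?_ hpos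
    linarith
  have hlim : ∀ q : ℝ, 0 < q →
      Filter.Tendsto (fun s : ℝ => s ^ q) (nhdsWithin 0 (Set.Ioi 0)) (nhds 0) := by
    intro q hq
    have := (Real.continuous_rpow_const hq.le).tendsto 0
    rw [Real.zero_rpow hq.ne'] at this
    exact this.mono_left nhdsWithin_le_nhds
  have hl := (((hlim (2 - 2 * m) (by linarith)).const_mul c).const_sub 1).const_mul ε
  have hr := (hlim (2 * m) (by linarith)).const_mul L
  have := le_of_tendsto_of_tendsto hl hr
    (Filter.eventually_of_mem (Ioo_mem_nhdsGT hρ) hq)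
  simp at this
  linarith

/-- The constant makes the barrier vanish at radius `r`. Beyond it, the factor `(‖y‖²)^(m-1) - c` is
nonpositive because `m ≤ 1`. -/
theorem radialBarrier_nonpos {m r : ℝ} (hm : m ≤ 1) (hr : 0 < r) {y : Plane} (hy : r ≤ ‖y‖) :
    radialBarrier m ((r ^ 2) ^ (m - 1)) y ≤ 0 := by
  have hy0 : 0 < ‖y‖ := hr.trans_le hy
  have h1 : (‖y‖ ^ 2) ^ (m - 1) ≤ (r ^ 2) ^ (m - 1) :=
    Real.rpow_le_rpow_of_nonpos (by positivity) (by gcongr) (by linarith)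
  have h2 : (‖y‖ ^ 2) ^ m = (‖y‖ ^ 2) ^ (m - 1) * ‖y‖ ^ 2 := by
    rw [Real.rpow_sub_one (by positivity)]
    field_simp
  rw [radialBarrier, h2, ← sub_mul]
  exact mul_nonpos_of_nonpos_of_nonneg (by linarith) (by positivity)

/-! ### Barriers on a cone surface -/

namespace ConeSurface

variable {M : Type*} [TopologicalSpace M]

theorem contDiffAt_comp_symm (C : ConeSurface M) {χ : OpenPartialHomeomorph C.Reg Plane}
    (hχ : χ ∈ C.charts) {f : M → ℝ} (hf : ContMDiff (𝓡 2) 𝓘(ℝ, ℝ) 2 (fun x : C.Reg => f x))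
    {y : Plane} (hy : y ∈ χ.target) :
    ContDiffAt ℝ 2 (fun y => f (χ.symm y : C.Reg)) y := by
  have h1 : ContMDiffAt (𝓡 2) (𝓡 2) 2 χ.symm y :=
    (contMDiffAt_symm_of_mem_maximalAtlas hχ hy).of_le (WithTop.coe_le_coe.mpr (le_top : (2 : ℕ∞) ≤ ⊤))
  exact (hf.contMDiffAt.comp y h1).contDiffAt

/-- A continuous function which vanishes at the cone points and is touched from below, at every
smooth point, by `C²` functions with Laplacian at least `-B`. -/
structure IsBarrier (C : ConeSurface M) (φ : M → ℝ) (B : ℝ) : Prop where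
  continuous : Continuous φ
  eq_zero : ∀ p ∈ C.sing, φ p = 0
  touch : ∀ x : C.Reg, ∃ χ ∈ C.charts, x ∈ χ.source ∧ ∃ w : Plane → ℝ,
    ContDiffAt ℝ 2 w (χ x) ∧ w (χ x) = φ x ∧
    (∀ᶠ y in nhds (χ x), w y ≤ φ (χ.symm y : C.Reg)) ∧
    -B ≤ coordLap (metricMatrix C.metric χ) w (χ x)

theorem isBarrier_zero (C : ConeSurface M) : C.IsBarrier (fun _ => 0) 0 where
  continuous := continuous_const
  eq_zero _ _ := rfl
  touch x := ⟨chartAt Plane x, IsManifold.chart_mem_maximalAtlas x, mem_chart_source _ x,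
    fun _ => 0, contDiffAt_const, rfl, by simp, by simp [coordLap_zero]⟩

/-- A function touching the larger of the two from below also touches the maximum, so no smoothness
of the maximum is needed. -/
theorem IsBarrier.max {C : ConeSurface M} {φ ψ : M → ℝ} {A B : ℝ} (hφ : C.IsBarrier φ A)
    (hψ : C.IsBarrier ψ B) : C.IsBarrier (fun x => max (φ x) (ψ x)) (max A B) where
  continuous := hφ.continuous.max hψ.continuous
  eq_zero p hp := by simp [hφ.eq_zero p hp, hψ.eq_zero p hp]
  touch x := by
    rcases le_total (ψ x) (φ x) with h | h
    · obtain ⟨χ, hχ, hx, w, hw, hwx, hle, hlap⟩ := hφ.touch x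
      exact ⟨χ, hχ, hx, w, hw, by rw [hwx, max_eq_left h],
        hle.mono fun _ hy => hy.trans (le_max_left _ _),
        (neg_le_neg (le_max_left A B)).trans hlap⟩
    · obtain ⟨χ, hχ, hx, w, hw, hwx, hle, hlap⟩ := hψ.touch x
      exact ⟨χ, hχ, hx, w, hw, by rw [hwx, max_eq_right h],
        hle.mono fun _ hy => hy.trans (le_max_right _ _),
        (neg_le_neg (le_max_right A B)).trans hlap⟩

/-- A continuous function, `C²` on the smooth part, with bounded gradient. -/
structure BoundedGrad (C : ConeSurface M) (f : M → ℝ) : Prop where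
  continuous : Continuous f
  contMDiff : ContMDiff (𝓡 2) 𝓘(ℝ, ℝ) 2 (fun x : C.Reg => f x)
  bound : ∃ K : ℝ, ∀ x : C.Reg, ∀ χ ∈ C.charts, x ∈ χ.source → C.gradNorm χ f x ≤ K

/-- Adding a positive multiple of `φ` to a function with bounded gradient prevents a maximum
at `p`. -/
def Dominates (C : ConeSurface M) (φ : M → ℝ) (p : M) : Prop :=
  ∀ f : M → ℝ, C.BoundedGrad f → ∀ ε > 0, ∃ x, f p < f x + ε * φ x

theorem Dominates.mono {C : ConeSurface M} {φ ψ : M → ℝ} {p : M} (h : C.Dominates φ p)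
    (hle : ∀ x, φ x ≤ ψ x) : C.Dominates ψ p := by
  intro f hf ε hε
  obtain ⟨x, hx⟩ := h f hf ε hε
  exact ⟨x, hx.trans_le (by have := mul_le_mul_of_nonneg_left (hle x) hε.le; linarith)⟩

theorem coneChart_symm_eq {S : Finset M} {κ : OpenPartialHomeomorph M Plane}
    {χ : OpenPartialHomeomorph {x : M // x ∉ S} Plane} {p : M} (hκp : κ p = 0)
    (hS : ∀ q ∈ κ.source, q ∈ S → q = p) (hsrc : χ.source = Subtype.val ⁻¹' κ.source)
    (hχκ : ∀ x ∈ χ.source, χ x = κ (x : M)) {y : Plane} (hy : y ∈ κ.target) (hy0 : y ≠ 0) :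
    y ∈ χ.target ∧ (χ.symm y : M) = κ.symm y := by
  have hm : κ.symm y ∈ κ.source := κ.map_target hy
  have hmS : κ.symm y ∉ S := fun h => hy0 (by rw [← κ.right_inv hy, hS _ hm h, hκp])
  have hx : (⟨κ.symm y, hmS⟩ : {x : M // x ∉ S}) ∈ χ.source := by rw [hsrc]; exact hm
  have hχy : χ ⟨κ.symm y, hmS⟩ = y := by rw [hχκ _ hx]; exact κ.right_inv hy
  refine ⟨hχy ▸ χ.map_source hx, ?_⟩
  conv_lhs => rw [← hχy, χ.left_inv hx]

open Classical in
/-- The positive part of a function in the coordinates `κ`, extended by zero. -/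
def extendPosPart (κ : OpenPartialHomeomorph M Plane) (b : Plane → ℝ) (x : M) : ℝ :=
  if x ∈ κ.source then max (b (κ x)) 0 else 0

theorem extendPosPart_of_mem {κ : OpenPartialHomeomorph M Plane} (b : Plane → ℝ) {x : M}
    (hx : x ∈ κ.source) : extendPosPart κ b x = max (b (κ x)) 0 := if_pos hx

theorem extendPosPart_nonneg (κ : OpenPartialHomeomorph M Plane) (b : Plane → ℝ) (x : M) :
    0 ≤ extendPosPart κ b x := by
  unfold extendPosPart
  split_ifs <;> simp

/-- The positive part lives on the preimage of `K`, which is compact and hence closed in the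
Hausdorff space `M`. Off that set the extension is locally zero. -/
theorem continuous_extendPosPart [T2Space M] {κ : OpenPartialHomeomorph M Plane} {b : Plane → ℝ}
    (hb : Continuous b) {K : Set Plane} (hK : IsCompact K) (hKt : K ⊆ κ.target)
    (hneg : ∀ y ∉ K, b y ≤ 0) : Continuous (extendPosPart κ b) := by
  rw [continuous_iff_continuousAt]
  intro x
  by_cases hx : x ∈ κ.source
  · have hev : (fun z => max (b (κ z)) 0) =ᶠ[nhds x] extendPosPart κ b := by
      filter_upwards [κ.open_source.mem_nhds hx] with z hz
      rw [extendPosPart_of_mem b hz]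
    exact ContinuousAt.congr ((hb.continuousAt.comp (κ.continuousAt hx)).max continuousAt_const) hev
  · have hcl : IsClosed (κ.symm '' K) :=
      (hK.image_of_continuousOn (κ.continuousOn_symm.mono hKt)).isClosed
    have hxK : x ∉ κ.symm '' K := by
      rintro ⟨y, hy, rfl⟩
      exact hx (κ.map_target (hKt hy))
    have hev : (fun _ => (0 : ℝ)) =ᶠ[nhds x] extendPosPart κ b := by
      filter_upwards [hcl.isOpen_compl.mem_nhds hxK] with z hz
      by_cases hzs : z ∈ κ.source
      · rw [extendPosPart_of_mem b hzs, max_eq_right]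
        exact hneg _ fun h => hz ⟨_, h, κ.left_inv hzs⟩
      · simp [extendPosPart, hzs]
    exact ContinuousAt.congr continuousAt_const hev

theorem exists_barrier_at [T2Space M] (C : ConeSurface M) {p : M} (hp : p ∈ C.sing) :
    ∃ φ B, C.IsBarrier φ B ∧ C.Dominates φ p := by
  obtain ⟨ρ, κ, χ, a, hρ, hpκ, hκp, htgt, hS, hχ, hsrc, hχκ, -, ⟨A, hA⟩, hG⟩ := C.cone p hp
  have hα := C.angle_pos p hp
  have hα' := C.angle_le p hp
  set γ : ℝ := C.angle p / (2 * Real.pi) with hγdef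
  have hγ : 0 < γ := by positivity
  have hγ1 : γ ≤ 1 := by rw [hγdef, div_le_one (by positivity)]; exact hα'
  -- The barrier grows like `r^{2m} = r^{γ/2}`, which beats `r^γ` near the tip.
  set m : ℝ := γ / 4 with hm
  have hm0 : 0 < m := by positivity
  have hm1 : m < 1 := by linarith
  -- With this `c` the barrier is nonpositive from radius `ρ / 2` on, well inside the disc.
  set c : ℝ := ((ρ / 2) ^ 2) ^ (m - 1) with hc
  have hc0 : 0 < c := by positivity
  have hsymm := fun {y} hy hy0 =>
    coneChart_symm_eq (y := y) hκp hS hsrc hχκ hy hy0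
  -- Here `γ ≤ 1`, i.e. cone angle at most `2π`, bounds the conformal factor away from zero.
  have hbnd : ∀ y ∈ Metric.ball (0 : Plane) ρ, y ≠ 0 →
      -(A - (γ - 1) * Real.log ρ) ≤ a y + (γ - 1) * Real.log ‖y‖ := by
    intro y hy hy0
    have h1 := neg_le_of_abs_le (hA y hy)
    have h2 : Real.log ‖y‖ ≤ Real.log ρ :=
      Real.log_le_log (norm_pos_iff.mpr hy0) (mem_ball_zero_iff.mp hy).le
    nlinarith
  refine ⟨extendPosPart κ (radialBarrier m c), 4 * c * Real.exp (2 * (A - (γ - 1) * Real.log ρ)),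
    ⟨?_, ?_, ?_⟩, ?_⟩
  · refine continuous_extendPosPart (continuous_radialBarrier hm0.le c)
      (isCompact_closedBall (0 : Plane) (ρ / 2)) ?_ ?_
    · rw [htgt]
      exact Metric.closedBall_subset_ball (by linarith)
    · intro y hy
      refine radialBarrier_nonpos hm1.le (by positivity) ?_
      simpa using (not_le.mp fun h => hy (mem_closedBall_zero_iff.mpr h)).le
  · intro q hq
    by_cases hqκ : q ∈ κ.source
    · rw [extendPosPart_of_mem _ hqκ, hS q hqκ hq, hκp]
      simp [radialBarrier, Real.zero_rpow hm0.ne']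
    · simp [extendPosPart, hqκ]
  · intro x
    -- Where the nonnegative barrier vanishes, the zero function touches it from below. This
    -- includes the circle on which the positive part may fail to be smooth.
    by_cases h0 : extendPosPart κ (radialBarrier m c) x = 0
    · refine ⟨chartAt Plane x, IsManifold.chart_mem_maximalAtlas x, mem_chart_source _ x,
        fun _ => 0, contDiffAt_const, h0.symm,
        Filter.Eventually.of_forall fun y => extendPosPart_nonneg _ _ _, ?_⟩
      rw [coordLap_zero]
      have : 0 ≤ 4 * c * Real.exp (2 * (A - (γ - 1) * Real.log ρ)) := by positivity
      linarith
    · have hxκ : (x : M) ∈ κ.source := by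
        by_contra h
        exact h0 (by simp [extendPosPart, h])
      have hxχ : x ∈ χ.source := by rw [hsrc]; exact hxκ
      have hxy : χ x = κ x := hχκ x hxχ
      have hpos : 0 < radialBarrier m c (χ x) := by
        by_contra! h
        exact h0 (by rw [extendPosPart_of_mem _ hxκ, ← hxy, max_eq_right h])
      have hy0 : χ x ≠ 0 := by
        intro h
        rw [h] at hpos
        simp [radialBarrier, Real.zero_rpow hm0.ne'] at hpos
      have hyB : χ x ∈ Metric.ball (0 : Plane) ρ := by
        rw [hxy, ← htgt]; exact κ.map_source hxκ
      refine ⟨χ, hχ, hxχ, radialBarrier m c, contDiffAt_radialBarrier m c hy0, ?_, ?_, ?_⟩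
      · rw [extendPosPart_of_mem _ hxκ, ← hxy, max_eq_left hpos.le]
      · filter_upwards [χ.open_target.mem_nhds (χ.map_source hxχ)] with y hy
        have h1 := χ.map_target hy
        have h2 : ((χ.symm y : C.Reg) : M) ∈ κ.source := by rw [hsrc] at h1; exact h1
        rw [extendPosPart_of_mem _ h2, ← hχκ _ h1, χ.right_inv hy]
        exact le_max_left _ _
      · have hev : ∀ᶠ z in nhds (χ x), metricMatrix C.metric χ z =
            Real.exp (2 * (a z + (γ - 1) * Real.log ‖z‖)) • (1 : Matrix (Fin 2) (Fin 2) ℝ) := by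
          filter_upwards [Metric.isOpen_ball.mem_nhds hyB, isOpen_ne.mem_nhds hy0]
            with z hz hz0 using hG z hz hz0
        rw [coordLap_conformal hev, flatLap_radialBarrier m c hy0, ← Real.exp_neg]
        have hE : Real.exp (-(2 * (a (χ x) + (γ - 1) * Real.log ‖χ x‖)))
            ≤ Real.exp (2 * (A - (γ - 1) * Real.log ρ)) := by
          apply Real.exp_le_exp.mpr
          linarith [hbnd _ hyB hy0]
        have hpw : 0 ≤ 4 * m ^ 2 * (‖χ x‖ ^ 2) ^ (m - 1) := by positivity
        have hE0 := Real.exp_pos (-(2 * (a (χ x) + (γ - 1) * Real.log ‖χ x‖)))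
        have h1 := mul_nonneg hE0.le hpw
        have h2 := mul_le_mul_of_nonneg_left hE (by positivity : 0 ≤ 4 * c)
        linarith
  · intro f hf ε hε
    by_contra! hmax
    obtain ⟨K, hK⟩ := hf.bound
    set e : Plane := stdVec 0 with he
    have hne : ‖e‖ = 1 := by simp [he, stdVec]
    have hball : ∀ s ∈ Set.Ico 0 ρ, s • e ∈ κ.target := by
      intro s hs
      rw [htgt, mem_ball_zero_iff, norm_smul, hne, mul_one, Real.norm_of_nonneg hs.1]
      exact hs.2
    have hnorm : ∀ s ∈ Set.Ioo 0 ρ, ‖s • e‖ = s := fun s hs => by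
      rw [norm_smul, hne, mul_one, Real.norm_of_nonneg hs.1.le]
    have hse0 : ∀ s ∈ Set.Ioo 0 ρ, s • e ≠ 0 := fun s hs => by
      rw [← norm_pos_iff, hnorm s hs]; exact hs.1
    have hcd : ∀ s ∈ Set.Ioo 0 ρ,
        HasDerivAt (fun s : ℝ => f (κ.symm (s • e)))
          (pd 0 (fun y => f (χ.symm y : C.Reg)) (s • e)) s := by
      intro s hs
      have htg := hball s ⟨hs.1.le, hs.2⟩
      have h1 := (C.contDiffAt_comp_symm hχ hf.contMDiff
        (hsymm htg (hse0 s hs)).1).differentiableAt (by norm_num)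
      have h2 := (hasDerivAt_id s).smul_const e
      rw [one_smul] at h2
      have h3 := h1.hasFDerivAt.comp_hasDerivAt s h2
      refine h3.congr_of_eventuallyEq ?_
      filter_upwards [Ioo_mem_nhds hs.1 hs.2] with z hz
      simp [(hsymm (hball z ⟨hz.1.le, hz.2⟩) (hse0 z hz)).2]
    -- The gradient bound is integrated along a ray from the tip; `r^{γ-1}` is integrable since `γ >
    -- 0`.
    have hlow : ∀ s ∈ Set.Ico 0 ρ,
        f p - (max K 0 * Real.exp A) / γ * s ^ γ ≤ f (κ.symm (s • e)) := by
      intro s hs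
      have h0 : f (κ.symm ((0 : ℝ) • e)) = f p := by
        rw [zero_smul, ← hκp, κ.left_inv hpκ]
      rw [← h0]
      refine sub_rpow_le_of_deriv_ge (h := fun s => f (κ.symm (s • e))) (ρ := ρ)
        hγ ?_ (fun s hs => (hcd s hs).differentiableAt) ?_ hs
      · exact hf.continuous.comp_continuousOn
          (κ.continuousOn_symm.comp (by fun_prop) hball)
      · intro s hs
        rw [(hcd s hs).deriv]
        have htg := hball s ⟨hs.1.le, hs.2⟩
        obtain ⟨hyt, -⟩ := hsymm htg (hse0 s hs)
        have h1 := hK (χ.symm (s • e)) χ hχ (χ.map_target hyt)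
        rw [htgt] at htg
        simp only [gradNorm, χ.right_inv hyt,
          coordGradNorm_conformal (hG _ htg (hse0 s hs))] at h1
        set P := pd 0 (fun y => f (χ.symm y : C.Reg)) (s • e) with hP
        set Q := pd 1 (fun y => f (χ.symm y : C.Reg)) (s • e) with hQ
        set E := a (s • e) + (γ - 1) * Real.log ‖s • e‖ with hE
        -- In this metric `|∇f|` is `e^{-E}` times the Euclidean norm of the gradient, which
        -- dominates a single partial derivative.
        have h2 : Real.exp (-E) * |P| ≤ max K 0 := by
          refine le_trans ?_ (h1.trans (le_max_left K 0))
          apply Real.le_sqrt_of_sq_le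
          have hexp : Real.exp (-E) ^ 2 = (Real.exp (2 * E))⁻¹ := by
            rw [← Real.exp_neg, ← Real.exp_nat_mul]; congr 1; push_cast; ring
          rw [mul_pow, sq_abs, hexp, Fin.sum_univ_two]
          have : 0 ≤ (Real.exp (2 * E))⁻¹ * Q ^ 2 := by positivity
          linarith
        have h3 : |P| ≤ max K 0 * Real.exp E := by
          rw [Real.exp_neg, inv_mul_eq_div, div_le_iff₀ (Real.exp_pos E)] at h2
          exact h2
        have h4 : Real.exp E ≤ Real.exp A * s ^ (γ - 1) := by
          rw [Real.rpow_def_of_pos hs.1, ← Real.exp_add]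
          apply Real.exp_le_exp.mpr
          have := le_of_abs_le (hA _ htg)
          rw [hE, hnorm s hs]
          linarith
        have h5 := mul_le_mul_of_nonneg_left h4 (le_max_right K 0)
        have h6 := neg_abs_le P
        linarith
    -- Maximality at the tip would bound `ε (r^{2m} - c r²)` by a multiple of `r^γ = r^{4m}`.
    refine not_forall_rpow_le (L := (max K 0 * Real.exp A) / γ) (c := c) hε hρ hm0 hm1 ?_
    intro s hs
    have hs' : s ∈ Set.Ico 0 ρ := ⟨hs.1.le, hs.2⟩
    have h1 := hlow s hs'
    have h2 := hmax (κ.symm (s • e))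
    rw [extendPosPart_of_mem _ (κ.map_target (hball s hs')), κ.right_inv (hball s hs')] at h2
    have h3 := mul_le_mul_of_nonneg_left (le_max_left (radialBarrier m c (s • e)) 0) hε.le
    rw [radialBarrier, hnorm s hs] at h3
    have h4 : 4 * m = γ := by rw [hm]; ring
    rw [h4]
    rw [radialBarrier, hnorm s hs] at h2
    linarith

theorem exists_barrier [T2Space M] (C : ConeSurface M) :
    ∃ φ B, C.IsBarrier φ B ∧ ∀ p ∈ C.sing, C.Dominates φ p := by
  suffices h : ∀ s : Finset M, s ⊆ C.sing →
      ∃ φ B, C.IsBarrier φ B ∧ ∀ p ∈ s, C.Dominates φ p from h _ subset_rfl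
  classical
  intro s
  induction s using Finset.induction_on with
  | empty => exact fun _ => ⟨_, _, C.isBarrier_zero, by simp⟩
  | insert q s _ ih =>
    intro hs
    rw [Finset.insert_subset_iff] at hs
    obtain ⟨φ, A, hφ, hφd⟩ := ih hs.2
    obtain ⟨ψ, B, hψ, hψd⟩ := C.exists_barrier_at hs.1
    refine ⟨_, _, hφ.max hψ, fun p hp => ?_⟩
    rcases Finset.mem_insert.mp hp with rfl | hp
    · exact hψd.mono fun x => le_max_right _ _
    · exact (hφd p hp).mono fun x => le_max_left _ _

end ConeSurface

/-! ### The maximum in space-time -/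

theorem le_derivWithin_of_forall_le {h : ℝ → ℝ} {T t k : ℝ} (ht : t ∈ Set.Ioc 0 T)
    (hd : DifferentiableWithinAt ℝ h (Set.Ioc 0 T) t)
    (hmax : ∀ s ∈ Set.Ioc 0 T, h s - k * s ≤ h t - k * t) :
    k ≤ derivWithin h (Set.Ioc 0 T) t := by
  have hder := hd.hasDerivWithinAt.sub ((hasDerivAt_id t).const_mul k).hasDerivWithinAt
  have hlm : IsLocalMaxOn (fun s => h s - k * s) (Set.Ioc 0 T) t :=
    Filter.eventually_of_mem self_mem_nhdsWithin hmax
  -- Only the backward direction is tested; it is admissible also at `t = T`.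
  have hmem : t / 2 - t ∈ posTangentConeAt (Set.Ioc 0 T) t := by
    apply sub_mem_posTangentConeAt_of_segment_subset
    exact (convex_Ioc 0 T).segment_subset ht ⟨by linarith [ht.1], by linarith [ht.1, ht.2]⟩
  have := hlm.hasFDerivWithinAt_nonpos hder.hasFDerivWithinAt hmem
  simp at this
  nlinarith [ht.1]

namespace ConeSurface

variable {M : Type*} [TopologicalSpace M]

theorem C21.boundedGrad {C : ConeSurface M} {T t : ℝ} {u : M → ℝ → ℝ} (hu : C.C21 T u)
    (hcont : ContinuousOn (fun z : M × ℝ => u z.1 z.2) (Set.univ ×ˢ Set.Icc (0 : ℝ) T))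
    (ht : t ∈ Set.Ioc 0 T) : C.BoundedGrad (fun q => u q t) where
  continuous := hcont.comp_continuous (by fun_prop : Continuous fun q : M => (q, t))
    fun _ => ⟨trivial, ht.1.le, ht.2⟩
  contMDiff := hu.space t ht
  bound := by
    obtain ⟨K, hK⟩ := hu.bound
    exact ⟨K, fun x χ hχ hx => ((hK t ht x).2 χ hχ hx).1⟩

/-- A maximum of `u + ε φ - k t` over space-time with `k > ε B` is attained only initially. -/
theorem time_eq_zero_of_isMaxOn {C : ConeSurface M} {T : ℝ} {u : M → ℝ → ℝ} (hu : C.C21 T u)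
    (hcont : ContinuousOn (fun z : M × ℝ => u z.1 z.2) (Set.univ ×ˢ Set.Icc (0 : ℝ) T))
    (hheat : C.HeatSubsolution T u) {φ : M → ℝ} {B : ℝ} (hφ : C.IsBarrier φ B)
    (hdom : ∀ p ∈ C.sing, C.Dominates φ p) {ε k : ℝ} (hε : 0 < ε) (hk : ε * B < k)
    {x : M} {t : ℝ} (ht : t ∈ Set.Icc 0 T)
    (hmax : ∀ y, ∀ s ∈ Set.Icc 0 T, u y s + ε * φ y - k * s ≤ u x t + ε * φ x - k * t) :
    t = 0 := by
  by_contra ht0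
  have ht' : t ∈ Set.Ioc 0 T := ⟨lt_of_le_of_ne ht.1 (Ne.symm ht0), ht.2⟩
  have hspace : ∀ y, u y t + ε * φ y ≤ u x t + ε * φ x := fun y => by linarith [hmax y t ht]
  by_cases hx : x ∈ C.sing
  · obtain ⟨y, hy⟩ := hdom x hx _ (hu.boundedGrad hcont ht') ε hε
    have := hspace y
    rw [hφ.eq_zero x hx] at this
    linarith
  · obtain ⟨χ, hχ, hxχ, w, hw, hwx, hle, hlap⟩ := hφ.touch ⟨x, hx⟩
    set x' : C.Reg := ⟨x, hx⟩ with hx'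
    have hU := C.contDiffAt_comp_symm hχ (f := fun q => u q t) (hu.space t ht') (χ.map_source hxχ)
    -- Replacing `φ` by `w` lowers nearby values and keeps the value at the point.
    have hloc : IsLocalMax (fun y => u (χ.symm y : C.Reg) t + ε * w y) (χ x') := by
      filter_upwards [hle] with y hy
      have h1 := hspace (χ.symm y : C.Reg)
      have h2 := mul_le_mul_of_nonneg_left hy hε.le
      rw [χ.left_inv hxχ, hwx]
      simp only [hx']
      linarith
    have h1 := coordLap_nonpos_of_isLocalMax (metricMatrix_posSemidef C.metric χ (χ x'))
      (hU.add (contDiffAt_const.mul hw)) hloc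
    rw [coordLap_add_const_mul _ hU hw] at h1
    have h2 := hheat t ht' x' χ hχ hxχ
    have h3 : k ≤ derivWithin (u x') (Set.Ioc 0 T) t :=
      le_derivWithin_of_forall_le ht' ((hu.time x').differentiableOn (by norm_num) t ht')
        fun s hs => by
          have := hmax x s ⟨hs.1.le, hs.2⟩
          simp only [hx']
          linarith
    have h4 := mul_le_mul_of_nonneg_left hlap hε.le
    simp only [lap] at h2
    linarith

end ConeSurface

end ConeMax

end

theorem theoremT {M : Type*} [TopologicalSpace M] [T2Space M] [CompactSpace M] [Nonempty M]
    (C : ConeMax.ConeSurface M) (T : ℝ) (hT : 0 < T) (u : M → ℝ → ℝ)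
    (hcont : ContinuousOn (fun z : M × ℝ => u z.1 z.2) (Set.univ ×ˢ Set.Icc (0 : ℝ) T))
    (hu : C.C21 T u) (hheat : C.HeatSubsolution T u) :
    ∃ y : M, IsMaxOn (fun z : M × ℝ => u z.1 z.2) (Set.univ ×ˢ Set.Icc (0 : ℝ) T) (y, 0) := by
  have h0T : (0 : ℝ) ∈ Set.Icc 0 T := ⟨le_rfl, hT.le⟩
  have hu0 : Continuous fun y => u y 0 :=
    hcont.comp_continuous (by fun_prop : Continuous fun q : M => (q, (0 : ℝ)))
      fun _ => ⟨trivial, h0T⟩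
  obtain ⟨φ, B, hφ, hdom⟩ := C.exists_barrier
  obtain ⟨y₀, -, hy₀⟩ := isCompact_univ.exists_isMaxOn Set.univ_nonempty hu0.continuousOn
  obtain ⟨b, hb⟩ := isCompact_univ.exists_bound_of_continuousOn hφ.continuous.continuousOn
  have hb' : ∀ y, |φ y| ≤ b := fun y => hb y trivial
  have hb0 : 0 ≤ b := (abs_nonneg _).trans (hb' y₀)
  refine ⟨y₀, ?_⟩
  rintro ⟨y, s⟩ ⟨-, hs⟩
  change u y s ≤ u y₀ 0
  -- `ε N` is what the perturbation can contribute when values of `v` are compared: twice the bound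
  -- for `ε φ`, plus `k T`. The choice of `ε` makes this half the supposed excess of `u`.
  set N : ℝ := 2 * b + (|B| + 1) * T with hN
  have hN0 : 0 < N := by positivity
  by_contra! hlt
  set ε : ℝ := (u y s - u y₀ 0) / (2 * N) with hεdef
  have hε : 0 < ε := div_pos (by linarith) (by linarith)
  have hεN : ε * N < u y s - u y₀ 0 := by
    have : ε * N = (u y s - u y₀ 0) / 2 := by rw [hεdef]; field_simp
    linarith
  set k : ℝ := ε * (|B| + 1) with hk
  have hv : ContinuousOn (fun z : M × ℝ => u z.1 z.2 + ε * φ z.1 - k * z.2)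
      (Set.univ ×ˢ Set.Icc (0 : ℝ) T) :=
    (hcont.add (continuous_const.mul (hφ.continuous.comp continuous_fst)).continuousOn).sub
      (continuous_const.mul continuous_snd).continuousOn
  obtain ⟨⟨x, t⟩, ⟨-, ht⟩, hmax⟩ := (isCompact_univ.prod isCompact_Icc).exists_isMaxOn
    ⟨(y₀, 0), trivial, h0T⟩ hv
  have hmax' : ∀ y, ∀ s ∈ Set.Icc 0 T, u y s + ε * φ y - k * s ≤ u x t + ε * φ x - k * t :=
    fun y s hs => hmax (⟨trivial, hs⟩ : (y, s) ∈ Set.univ ×ˢ Set.Icc (0 : ℝ) T)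
  obtain rfl : t = 0 := ConeMax.ConeSurface.time_eq_zero_of_isMaxOn hu hcont hheat hφ hdom hε
    (mul_lt_mul_of_pos_left (by linarith [le_abs_self B]) hε) ht hmax'
  have h1 := hmax' y s hs
  have h2 : u x 0 ≤ u y₀ 0 := hy₀ (Set.mem_univ x)
  have h3 := mul_le_mul_of_nonneg_left (le_of_abs_le (hb' x)) hε.le
  have h4 := mul_le_mul_of_nonneg_left (neg_le_of_abs_le (hb' y)) hε.le
  have h5 : k * s ≤ k * T := mul_le_mul_of_nonneg_left hs.2 (by positivity)
  have h6 : ε * N = ε * b + ε * b + k * T := by rw [hN, hk]; ring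
  linarith
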